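/- Let $V$ be an $n$-dimensional vector space over a finite field $\mathbb{F}_q$, and let $X_V$ be the order complex of the poset of linear subspaces $0 \neq U \subsetneq V$, ordered by inclusion: its $p$-simplices are the flags $\sigma = [U_1 \subsetneq \cdots \subsetneq U_{p+1}]$ of such subspaces ($p \geq -1$, the empty flag being the only simplex of dimension $-1$). Let $\mathfrak{g}$ be the local system on $X_V$ with $\mathfrak{g}(U_1 \subsetneq \cdots \subsetneq U_{\ell}) = U_1$ and $\mathfrak{g}(\emptyset) = V$, whose connecting maps $\mathfrak g(\tau)\to\mathfrak g(\sigma)$, $\sigma\subset\tau$, are the inclusions, and let $\wedge^k \mathfrak{g}$ be its $k$-th exterior power. A $p$-chain with coefficients in $\wedge^k\mathfrak{g}$ is a formal sum $c = \sum_{\sigma} c(\sigma)\,\sigma$ over the $p$-simplices $\sigma$ with $c(\sigma) \in \wedge^k \mathfrak{g}(\sigma)$; its support is $\mathrm{supp}(c) = \{\sigma : c(\sigma) \neq 0\}$. The boundary of $c$ is $\partial_p c = \sum_{\sigma} \sum_{i=1}^{p+1} (-1)^{i+1} c(\sigma)\, \sigma_i$, where $\sigma_i$ is obtained from $\sigma$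 by deleting $U_i$ and $c(\sigma)$ is mapped to $\wedge^k\mathfrak{g}(\sigma_i)$ by the connecting map. Let $1 \leq k \leq n-1$ and let $\mathcal{D}^k(V) = \tilde H_{n-k-1}(X_V; \wedge^k \mathfrak{g})$ be the homology in degree $n-k-1$ of this complex (which includes degree $-1$). Then every element $w$ of $\mathcal{D}^k(V)$ is represented by exactly one cycle, whose support is denoted by $\mathrm{supp}(w)$, and $$\min\big\{\, |\mathrm{supp}(w)| : 0 \neq w \in \mathcal{D}^k(V) \,\big\} = \frac{(n-k+2)!}{2}.$$ -/

import Mathlib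

noncomputable section

namespace TwistedBuilding

universe u v w

section LocalSystems

variable (R : Type u) [CommRing R] (P : Type v) [PartialOrder P]

/-- The order complex of a poset `P`: its simplices are the finite chains of `P`,
the empty chain (the simplex of dimension `-1`) included. -/
def OrderComplex : Type v := {σ : Finset P // IsChain (· ≤ ·) (σ : Set P)}

/-- The simplices of dimension `p ≥ -1`: the chains with `p + 1` elements. -/
def Simplex (p : ℤ) : Type v := {σ : OrderComplex P // (σ.1.card : ℤ) = p + 1}

instance [Finite P] : Finite (OrderComplex P) := inferInstanceAs (Finite {_σ : Finset P // _})

instance [Finite P] (p : ℤ) : Finite (Simplex P p) :=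
  inferInstanceAs (Finite {_σ : OrderComplex P // _})

instance [Finite P] (p : ℤ) : Fintype (Simplex P p) := Fintype.ofFinite _

/-- A local system of `R`-modules on the order complex of `P`; `map` is the connecting
homomorphism `ρ_σ^τ : F(τ) → F(σ)` for `σ ⊆ τ`. -/
structure LocalSystem where
  obj : OrderComplex P → Type w
  [addCommGroup : ∀ σ, AddCommGroup (obj σ)]
  [module : ∀ σ, Module R (obj σ)]
  map : ∀ {σ τ : OrderComplex P}, σ.1 ⊆ τ.1 → (obj τ →ₗ[R] obj σ)
  map_id : ∀ σ : OrderComplex P, map (Finset.Subset.refl σ.1) = LinearMap.id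
  map_comp : ∀ {η σ τ : OrderComplex P} (h : η.1 ⊆ σ.1) (h' : σ.1 ⊆ τ.1),
    map h ∘ₗ map h' = map (h.trans h')

end LocalSystems

attribute [instance] LocalSystem.addCommGroup LocalSystem.module

namespace LocalSystem

variable {R : Type u} [CommRing R] {P : Type v} [PartialOrder P]

/-- The `k`-th exterior power of a local system, taken simplex by simplex. -/
def extPower (F : LocalSystem.{u, v, w} R P) (k : ℕ) : LocalSystem.{u, v, max u w} R P where
  obj σ := ⋀[R]^k (F.obj σ)
  map h := exteriorPower.map k (F.map h)
  map_id σ := by rw [F.map_id, exteriorPower.map_id]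
  map_comp h h' := by rw [← F.map_comp h h', exteriorPower.map_comp]

variable (F : LocalSystem.{u, v, w} R P)

/-- The `F`-twisted chains of dimension `p`, as functions `σ ↦ c(σ) ∈ F(σ)` on the `p`-simplices
(used only for finite `P`, where these are the same as formal linear combinations). -/
abbrev Chain (p : ℤ) : Type (max v w) := (σ : Simplex P p) → F.obj σ.1

/-- The support of a twisted chain. -/
def supp {F : LocalSystem.{u, v, w} R P} {p : ℤ} (c : F.Chain p) : Set (Simplex P p) :=
  {σ | c σ ≠ 0}

open Classical in
/-- The boundary map from `p`-chains to `r`-chains, to be used for `r = p - 1` (it is zero for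
every other `r`). The face of `τ` opposite to its vertex `s` enters with the sign `(-1)^j`, where
`j` is the number of vertices of `τ` below `s`; so `s` is the `(j+1)`-st vertex of `τ` and
`(-1)^j = (-1)^((j+1)+1)`. -/
def boundary [Finite P] (p r : ℤ) : F.Chain p →ₗ[R] F.Chain r where
  toFun c σ := ∑ τ : Simplex P p, ∑ s ∈ τ.1.1,
    if h : σ.1.1 = τ.1.1.erase s then
      ((-1 : R) ^ (τ.1.1.filter (· < s)).card) •
        F.map (h.trans_subset (Finset.erase_subset s τ.1.1)) (c τ)
    else 0
  map_add' c d := by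
    funext σ
    simp only [Pi.add_apply, ← Finset.sum_add_distrib]
    refine Finset.sum_congr rfl fun τ _ => Finset.sum_congr rfl fun s _ => ?_
    split_ifs <;> simp
  map_smul' a c := by
    funext σ
    simp only [Pi.smul_apply, RingHom.id_apply, Finset.smul_sum]
    refine Finset.sum_congr rfl fun τ _ => Finset.sum_congr rfl fun s _ => ?_
    split_ifs
    · rw [map_smul, smul_comm]
    · simp

/-- The `p`-cycles of the reduced chain complex. -/
abbrev cycles [Finite P] (p : ℤ) : Submodule R (F.Chain p) :=
  LinearMap.ker (F.boundary p (p - 1))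

/-- The `p`-boundaries of the reduced chain complex. -/
abbrev boundaries [Finite P] (p : ℤ) : Submodule R (F.Chain p) :=
  LinearMap.range (F.boundary (p + 1) p)

/-- The reduced homology of the order complex of `P` in degree `p` with coefficients in `F`:
cycles modulo boundaries. -/
abbrev reducedHomology [Finite P] (p : ℤ) : Type (max v w) :=
  F.cycles p ⧸ (F.boundaries p).submoduleOf (F.cycles p)

/-- The homology class of a cycle. -/
def homologyClass [Finite P] {p : ℤ} (z : F.cycles p) : F.reducedHomology p :=
  Submodule.Quotient.mk z

end LocalSystem

section Building

variable (K : Type u) (V : Type v) [Field K] [AddCommGroup V] [Module K V]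

/-- The vertices of the spherical building `X_V`: the subspaces `0 ≠ U ⊊ V`, ordered by inclusion.
The building `X_V` is the order complex of this poset. -/
abbrev Vertex : Type v := {U : Submodule K V // U ≠ ⊥ ∧ U ≠ ⊤}

instance [Finite K] [FiniteDimensional K V] : Finite (Vertex K V) :=
  haveI : Finite V := Module.finite_of_finite K
  haveI : Finite (Submodule K V) := Finite.of_injective _ SetLike.coe_injective
  inferInstance

variable {K V}

/-- The intersection of the members of a flag; it is the smallest member `U₁` of a nonempty flag
`U₁ ⊊ ⋯ ⊊ U_ℓ` (`bottom_eq`) and all of `V` for the empty flag (`bottom_empty`). -/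
def bottom (σ : OrderComplex (Vertex K V)) : Submodule K V := σ.1.inf Subtype.val

theorem bottom_eq (σ : OrderComplex (Vertex K V)) (U : Vertex K V) (hU : U ∈ σ.1)
    (hmin : ∀ W ∈ σ.1, U ≤ W) : bottom σ = U.1 :=
  le_antisymm (Finset.inf_le (f := Subtype.val) hU) (Finset.le_inf fun W hW => hmin W hW)

theorem bottom_empty (σ : OrderComplex (Vertex K V)) (h : σ.1 = ∅) : bottom σ = ⊤ := by
  simp [bottom, h]

variable (K V)

/-- The local system `𝔤` on `X_V`: `𝔤(U₁ ⊊ ⋯ ⊊ U_ℓ) = U₁` and `𝔤(∅) = V`, with the inclusions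
as connecting homomorphisms. -/
def lusztig : LocalSystem.{u, v, v} K (Vertex K V) where
  obj σ := bottom σ
  map h := Submodule.inclusion (Finset.inf_mono h)
  map_id _ := rfl
  map_comp _ _ := rfl

/-- The dimension `n - k - 1` of the simplices carrying `𝒟^k(V)`, where `n = dim V`. -/
abbrev degD (k : ℕ) : ℤ := (Module.finrank K V : ℤ) - k - 1

/-- `𝒟^k(V) = H̃_{n-k-1}(X_V; ⋀^k 𝔤)`, where `n = dim V`. -/
abbrev D [Finite K] [FiniteDimensional K V] (k : ℕ) : Type (max u v) :=
  ((lusztig K V).extPower k).reducedHomology (degD K V k)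

/-- The cycles representing the elements of `𝒟^k(V)`. -/
abbrev cyclesD [Finite K] [FiniteDimensional K V] (k : ℕ) :
    Submodule K (((lusztig K V).extPower k).Chain (degD K V k)) :=
  ((lusztig K V).extPower k).cycles (degD K V k)

end Building

end TwistedBuilding

end

/-!
No `(n - k)`-simplex carries a nonzero coefficient: its bottom has dimension less than `k`. Hence
there are no boundaries, and a homology class is the same thing as a cycle.

For the lower bound, the flags in the support of a nonzero cycle are saturated chains
`U_k ⋖ ⋯ ⋖ U_{n-1}` with `dim U_j = j`. A facet of such a flag lies in at least two members of the
support, and in at least three if the vertex `U_k` was deleted, because distinct `k`-dimensional `U`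
have distinct lines `⋀ᵏ U`. An induction on `n - k` shows that a family of chains with this exchange
property has at least `(n - k + 2)! / 2` members: two hyperplanes `H ≠ H'` through `U_{n-2}`
determine it as `H ⊓ H'`, so the number of hyperplanes grows by at least one in each step.

For the upper bound, take `n - k + 2` points of `V` that form a circuit modulo a fixed
`(k - 1)`-dimensional core. Every ordering of the points gives a flag, spanned by the core and the
differences of the points in the initial segments of the ordering, and the coefficient is the sum
over the orderings `r` with this flag of `sign r • (p_{r 0} ∧ core)`. Swapping the first two points
does not change the flag, so at most `(n - k + 2)! / 2` flags occur.
-/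

noncomputable section

namespace TwistedBuilding

section Exchange

variable {L : Type*} {k n : ℕ} {S : Finset (ℕ → L)}

/-- A family of saturated chains `f k ⋖ ⋯ ⋖ f (n - 1)` (values outside `[k, n)` are ignored by the
covering condition) in which every member of every chain can be exchanged for another one, and the
lowest member for at least two others, without leaving the family. -/
structure IsExchangeable [Preorder L] (k n : ℕ) (S : Finset (ℕ → L)) : Prop where
  covBy : ∀ f ∈ S, ∀ j, k ≤ j → j + 1 < n → f j ⋖ f (j + 1)
  nontrivial : ∀ f ∈ S, ∀ j, k ≤ j → j < n → {x | Function.update f j x ∈ S}.Nontrivial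
  two_lt_encard : k < n → ∀ f ∈ S, 2 < {x | Function.update f k x ∈ S}.encard

namespace IsExchangeable

theorem filter_eq [DecidableEq L] [Preorder L] (hS : IsExchangeable k (n + 1) S) (x : L) :
    IsExchangeable k n {f ∈ S | f n = x} := by
  have update_mem {f j} (hf : f ∈ S ∧ f n = x) (hj : j < n) :
      {y | Function.update f j y ∈ ({f ∈ S | f n = x} : Finset _)} =
        {y | Function.update f j y ∈ S} := by
    ext y
    simp [Function.update_of_ne hj.ne', hf.2]
  refine ⟨fun f hf j hkj hjn => ?_, fun f hf j hkj hjn => ?_, fun hkn f hf => ?_⟩ <;>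
    rw [Finset.mem_filter] at hf
  · exact hS.covBy f hf.1 j hkj (by omega)
  · rw [update_mem hf hjn]
    exact hS.nontrivial f hf.1 j hkj (by omega)
  · rw [update_mem hf hkn]
    exact hS.two_lt_encard (by omega) f hf.1

variable [SemilatticeInf L]

theorem le_card_image [DecidableEq L] (hkn : k ≤ n) (hS : IsExchangeable k (n + 1) S)
    (hne : S.Nonempty) : n - k + 3 ≤ (S.image (· n)).card := by
  obtain ⟨f, hf⟩ := hne
  induction n, hkn using Nat.le_induction generalizing S f with
  | base =>
    have hsub : {x | Function.update f k x ∈ S} ⊆ ↑(S.image (· k)) := fun x hx => by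
      simpa using ⟨_, hx, Function.update_self k x f⟩
    have hlt := (hS.two_lt_encard (by omega) f hf).trans_le (Set.encard_le_encard hsub)
    rw [Set.encard_coe_eq_coe_finsetCard] at hlt
    have : 2 < (S.image (· k)).card := by exact_mod_cast hlt
    omega
  | succ n hkn ih =>
    set H := f (n + 1)
    set T : Finset (ℕ → L) := {g ∈ S | g (n + 1) = H}
    -- Exchanging the member `H` of a chain through `W ⋖ H` yields `H' ≠ H` with `W = H ⊓ H'`.
    have hsub : T.image (· n) ⊆ ((S.image (· (n + 1))).erase H).image (H ⊓ ·) := by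
      intro W hW
      obtain ⟨g, hg, rfl⟩ := Finset.mem_image.1 hW
      obtain ⟨hgS, hgH⟩ := Finset.mem_filter.1 hg
      obtain ⟨H', hH'S, hH'⟩ := (hS.nontrivial g hgS (n + 1) (by omega) (by omega)).exists_ne H
      have hcov : g n ⋖ H := hgH ▸ hS.covBy g hgS n hkn (by omega)
      have hcov' : g n ⋖ H' := by simpa using hS.covBy _ hH'S n hkn (by omega)
      refine Finset.mem_image.2 ⟨H', Finset.mem_erase.2 ⟨hH', ?_⟩, ?_⟩
      · exact Finset.mem_image.2 ⟨_, hH'S, Function.update_self ..⟩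
      · exact hcov.wcovBy.toDual.sup_eq hcov'.wcovBy.toDual hH'.symm
    calc n + 1 - k + 3 = (n - k + 3) + 1 := by omega
      _ ≤ (T.image (· n)).card + 1 := by
        gcongr
        exact ih (hS.filter_eq H) f (Finset.mem_filter.2 ⟨hf, rfl⟩)
      _ ≤ ((S.image (· (n + 1))).erase H).card + 1 := by
        exact Nat.add_le_add_right ((Finset.card_le_card hsub).trans Finset.card_image_le) 1
      _ = (S.image (· (n + 1))).card :=
        Finset.card_erase_add_one (Finset.mem_image_of_mem (· (n + 1)) hf)

theorem factorial_le_two_mul_card (hkn : k ≤ n) (hS : IsExchangeable k n S) (hne : S.Nonempty) :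
    (n - k + 2).factorial ≤ 2 * S.card := by
  classical
  induction n, hkn using Nat.le_induction generalizing S with
  | base => simpa using hne
  | succ n hkn ih =>
    have hfiber : ∀ H ∈ S.image (· n), (n - k + 2).factorial ≤ 2 * {f ∈ S | f n = H}.card := by
      intro H hH
      obtain ⟨f, hf, rfl⟩ := Finset.mem_image.1 hH
      exact ih (hS.filter_eq _) ⟨f, Finset.mem_filter.2 ⟨hf, rfl⟩⟩
    calc (n + 1 - k + 2).factorial = (n - k + 3) * (n - k + 2).factorial := by
          rw [Nat.succ_sub hkn, Nat.succ_eq_add_one, add_right_comm, Nat.factorial_succ]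
      _ ≤ (S.image (· n)).card * (n - k + 2).factorial := by
          gcongr
          exact hS.le_card_image hkn hne
      _ ≤ ∑ H ∈ S.image (· n), 2 * {f ∈ S | f n = H}.card := by
          rw [← smul_eq_mul]
          exact Finset.card_nsmul_le_sum _ _ _ hfiber
      _ = 2 * S.card := by rw [← Finset.mul_sum, ← Finset.card_eq_sum_card_image]

end IsExchangeable

end Exchange

section ExteriorPower

variable {K V : Type*} [Field K] [AddCommGroup V] [Module K V]

theorem subsingleton_exteriorPower_of_finrank_lt [FiniteDimensional K V] {k : ℕ}
    (h : Module.finrank K V < k) : Subsingleton (⋀[K]^k V) := by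
  rw [← Module.finrank_zero_iff (R := K), exteriorPower.finrank_eq, Nat.choose_eq_zero_of_lt h]

theorem exists_linearMap_eq_self_and_mem_inf (A B : Submodule K V) :
    ∃ f : V →ₗ[K] V, (∀ a ∈ A, f a = a) ∧ ∀ b ∈ B, f b ∈ A ⊓ B := by
  obtain ⟨B', hdisj, hsup⟩ := IsModularLattice.exists_disjoint_and_sup_eq (inf_le_right : A ⊓ B ≤ B)
  have hAB' : Disjoint B' A := by
    rw [disjoint_iff, ← inf_eq_right.2 (hsup ▸ le_sup_right : B' ≤ B)]
    rw [inf_right_comm, inf_comm B A]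
    exact hdisj.eq_bot
  obtain ⟨C, hB'C, hC⟩ := hAB'.exists_isCompl
  refine ⟨A.projection C hC.symm, fun a ha => Submodule.projection_apply_of_mem_left _ ha, ?_⟩
  intro b hb
  obtain ⟨a, ha, b', hb', rfl⟩ := Submodule.mem_sup.1 (hsup.symm ▸ hb)
  rw [map_add, Submodule.projection_apply_of_mem_left _ ha.1,
    (Submodule.projection_apply_eq_zero_iff _).2 (hB'C hb'), add_zero]
  exact ha

theorem range_exteriorPower_map_subtype_inf_le (k : ℕ) (A B : Submodule K V) :
    LinearMap.range (exteriorPower.map k A.subtype) ⊓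
        LinearMap.range (exteriorPower.map k B.subtype) ≤
      LinearMap.range (exteriorPower.map k (A ⊓ B).subtype) := by
  obtain ⟨f, hfA, hfB⟩ := exists_linearMap_eq_self_and_mem_inf A B
  rintro _ ⟨⟨x, rfl⟩, ⟨y, hyx⟩⟩
  let g : B →ₗ[K] (A ⊓ B : Submodule K V) := (f ∘ₗ B.subtype).codRestrict _ fun b => hfB b b.2
  have hfA' : f ∘ₗ A.subtype = A.subtype := LinearMap.ext fun a => hfA a a.2
  refine ⟨exteriorPower.map k g y, ?_⟩
  calc exteriorPower.map k (A ⊓ B).subtype (exteriorPower.map k g y)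
      = exteriorPower.map k f (exteriorPower.map k B.subtype y) := by
        simp only [← LinearMap.comp_apply, ← exteriorPower.map_comp]
        rfl
    _ = exteriorPower.map k A.subtype x := by
        rw [hyx, ← LinearMap.comp_apply, ← exteriorPower.map_comp, hfA']

theorem disjoint_range_exteriorPower_map_subtype {k : ℕ} {A B : Submodule K V}
    [FiniteDimensional K (A ⊓ B : Submodule K V)]
    (h : Module.finrank K (A ⊓ B : Submodule K V) < k) :
    Disjoint (LinearMap.range (exteriorPower.map k A.subtype))
      (LinearMap.range (exteriorPower.map k B.subtype)) := by
  have := subsingleton_exteriorPower_of_finrank_lt h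
  rw [disjoint_iff, eq_bot_iff, ← LinearMap.range_eq_bot.2 (Subsingleton.elim
    (exteriorPower.map k (A ⊓ B).subtype) 0)]
  exact range_exteriorPower_map_subtype_inf_le k A B

theorem exteriorPower_ιMulti_ne_zero {k : ℕ} {v : Fin k → V} (hv : LinearIndependent K v) :
    exteriorPower.ιMulti K k v ≠ 0 := by
  have h := (exteriorPower.ιMulti_family_linearIndependent_field (n := k) hv).ne_zero
    (Set.powersetCard.ofFinEmbEquiv (RelEmbedding.refl _))
  simpa [exteriorPower.ιMulti_family] using h

end ExteriorPower

section LocalSystems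

variable {P : Type*} [PartialOrder P]

open Classical in
/-- The incidence number `[τ : ρ]` of two chains: the sign with which `ρ` occurs in the boundary of
`τ`, and `0` if `ρ` is not a facet of `τ`. -/
def incidence (R : Type*) [CommRing R] (ρ τ : Finset P) : R :=
  ∑ s ∈ τ, if ρ = τ.erase s then (-1) ^ (τ.filter (· < s)).card else 0

variable {R : Type*} [CommRing R]

theorem incidence_eq_zero {ρ τ : Finset P} (h : ¬ρ ⋖ τ) : incidence R ρ τ = 0 := by
  classical
  refine Finset.sum_eq_zero fun s hs => if_neg ?_
  rintro rfl
  exact h (by convert Finset.erase_covBy hs)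

theorem isUnit_incidence {ρ τ : Finset P} (h : ρ ⋖ τ) : IsUnit (incidence R ρ τ) := by
  classical
  obtain ⟨s, hs, rfl⟩ := Finset.covBy_iff_exists_erase.1 h
  rw [incidence, Finset.sum_eq_single_of_mem s hs fun t _ hts => if_neg ?_, if_pos (by congr)]
  · exact isUnit_one.neg.pow _
  · exact fun he => hts ((Finset.erase_inj τ hs).1 (by convert he)).symm

theorem incidence_image_univ [DecidableEq P] {m : ℕ} {v : Fin m → P} (hv : StrictMono v)
    (ρ : Finset P) :
    incidence R ρ (Finset.univ.image v) =
      ∑ i, if ρ = (Finset.univ.erase i).image v then (-1) ^ (i : ℕ) else 0 := by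
  classical
  rw [incidence, Finset.sum_image hv.injective.injOn]
  refine Finset.sum_congr rfl fun i _ => ?_
  rw [Finset.image_erase hv.injective, Finset.filter_image,
    Finset.card_image_of_injective _ hv.injective]
  simp only [hv.lt_iff_lt, Finset.filter_gt_eq_Iio, Fin.card_Iio]
  congr!

end LocalSystems

namespace LocalSystem

variable {R P M : Type*} [CommRing R] [PartialOrder P] {F : LocalSystem R P}

/-- The simplices in the support of a chain that have `ρ` as a facet. -/
def suppCofacets {p r : ℤ} (c : F.Chain p) (ρ : Simplex P r) : Set (Simplex P p) :=
  {τ ∈ supp c | ρ.1.1 ⋖ τ.1.1}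

variable [AddCommGroup M] [Module R M] {e : ∀ σ : OrderComplex P, F.obj σ →ₗ[R] M}

section

variable [Finite P]

theorem apply_boundary (he : ∀ {σ τ} (h : σ.1 ⊆ τ.1) x, e σ (F.map h x) = e τ x) {p r : ℤ}
    (c : F.Chain p) (ρ : Simplex P r) :
    e ρ.1 (F.boundary p r c ρ) = ∑ τ, incidence R ρ.1.1 τ.1.1 • e τ.1 (c τ) := by
  simp only [boundary, LinearMap.coe_mk, AddHom.coe_mk, map_sum, incidence, Finset.sum_smul]
  refine Finset.sum_congr rfl fun τ _ => Finset.sum_congr rfl fun s _ => ?_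
  split_ifs
  · rw [map_smul, he]
  · rw [map_zero, zero_smul]

theorem mem_cycles_iff (he : ∀ {σ τ} (h : σ.1 ⊆ τ.1) x, e σ (F.map h x) = e τ x)
    (hinj : ∀ σ, Function.Injective (e σ)) {p : ℤ} {c : F.Chain p} :
    c ∈ F.cycles p ↔
      ∀ ρ : Simplex P (p - 1), ∑ τ, incidence R ρ.1.1 τ.1.1 • e τ.1 (c τ) = 0 := by
  simp only [LinearMap.mem_ker, funext_iff, Pi.zero_apply, ← apply_boundary he,
    map_eq_zero_iff _ (hinj _)]

variable (he : ∀ {σ τ} (h : σ.1 ⊆ τ.1) x, e σ (F.map h x) = e τ x)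
  (hinj : ∀ σ, Function.Injective (e σ)) {p : ℤ} {c : F.Chain p} (hc : c ∈ F.cycles p)
  {ρ : Simplex P (p - 1)}

include he hinj hc

theorem sum_incidence_smul_eq_zero {T : Finset (Simplex P p)} (hT : suppCofacets c ρ ⊆ T) :
    ∑ τ ∈ T, incidence R ρ.1.1 τ.1.1 • e τ.1 (c τ) = 0 := by
  rw [← (mem_cycles_iff he hinj).1 hc ρ]
  refine Finset.sum_subset (Finset.subset_univ T) fun τ _ hτ => ?_
  by_cases hcov : ρ.1.1 ⋖ τ.1.1
  · rw [not_ne_iff.1 fun hne => hτ (hT ⟨hne, hcov⟩), map_zero, smul_zero]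
  · rw [incidence_eq_zero hcov, zero_smul]

theorem nontrivial_suppCofacets (hne : (suppCofacets c ρ).Nonempty) :
    (suppCofacets c ρ).Nontrivial := by
  obtain ⟨τ, hτ⟩ := hne
  by_contra hnt
  have hsub : suppCofacets c ρ ⊆ ({τ} : Finset _) := by
    simpa using (Set.not_nontrivial_iff.1 hnt).eq_singleton_of_mem hτ |>.subset
  have hsum := sum_incidence_smul_eq_zero he hinj hc hsub
  rw [Finset.sum_singleton, (isUnit_incidence hτ.2).smul_eq_zero] at hsum
  exact hτ.1 ((map_eq_zero_iff _ (hinj _)).1 hsum)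

theorem two_lt_encard_suppCofacets (hne : (suppCofacets c ρ).Nonempty)
    (hdisj : (suppCofacets c ρ).Pairwise fun σ τ =>
      Disjoint (LinearMap.range (e σ.1)) (LinearMap.range (e τ.1))) :
    2 < (suppCofacets c ρ).encard := by
  classical
  obtain ⟨σ, hσ, τ, hτ, hστ⟩ := nontrivial_suppCofacets he hinj hc hne
  by_contra! hle
  have hpair : {σ, τ} = suppCofacets c ρ :=
    (Set.toFinite _).eq_of_subset_of_encard_le (Set.pair_subset hσ hτ)
      (hle.trans_eq (Set.encard_pair hστ).symm)
  have hsum := sum_incidence_smul_eq_zero he hinj hc (ρ := ρ) (T := {σ, τ})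
    (by simp [← hpair])
  rw [Finset.sum_pair hστ] at hsum
  have hzero : incidence R ρ.1.1 σ.1.1 • e σ.1 (c σ) = 0 :=
    Submodule.disjoint_def.1 (hdisj hσ hτ hστ) _ (Submodule.smul_mem _ _ ⟨_, rfl⟩)
      (eq_neg_of_add_eq_zero_left hsum ▸ neg_mem (Submodule.smul_mem _ _ ⟨_, rfl⟩))
  rw [(isUnit_incidence hσ.2).smul_eq_zero] at hzero
  exact hσ.1 ((map_eq_zero_iff _ (hinj _)).1 hzero)

end

theorem homologyClass_bijective [Finite P] {p : ℤ} [Subsingleton (F.Chain (p + 1))] :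
    Function.Bijective (F.homologyClass (p := p)) := by
  refine ⟨fun z z' h => ?_, Submodule.Quotient.mk_surjective _⟩
  obtain ⟨b, hb⟩ := (Submodule.Quotient.eq _).1 h
  rw [Subsingleton.elim b 0, map_zero] at hb
  exact sub_eq_zero.1 (Subtype.ext hb.symm)

theorem homologyClass_eq_zero_iff [Finite P] {p : ℤ} [Subsingleton (F.Chain (p + 1))]
    {z : F.cycles p} : F.homologyClass z = 0 ↔ z = 0 :=
  homologyClass_bijective.1.eq_iff' rfl

end LocalSystem

open Module (finrank)

section Flags

variable {K V : Type*} [Field K] [AddCommGroup V] [Module K V]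

theorem bottom_le {σ : OrderComplex (Vertex K V)} {U : Vertex K V} (hU : U ∈ σ.1) :
    bottom σ ≤ U.1 :=
  Finset.inf_le (f := Subtype.val) hU

/-- The type of a flag: the set of dimensions of its members. -/
def flagType (σ : OrderComplex (Vertex K V)) : Finset ℕ := σ.1.image fun U => finrank K U.1

theorem mem_flagType {σ : OrderComplex (Vertex K V)} {d : ℕ} :
    d ∈ flagType σ ↔ ∃ U ∈ σ.1, finrank K U.1 = d :=
  Finset.mem_image

theorem finrank_mem_flagType {σ : OrderComplex (Vertex K V)} {U : Vertex K V} (hU : U ∈ σ.1) :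
    finrank K U.1 ∈ flagType σ :=
  Finset.mem_image_of_mem _ hU

open Classical in
/-- The member of dimension `d` of a flag, or `V` if the flag has none. -/
def member (σ : OrderComplex (Vertex K V)) (d : ℕ) : Submodule K V :=
  (σ.1.filter fun U => finrank K U.1 = d).inf Subtype.val

variable [FiniteDimensional K V]

theorem injOn_finrank (σ : OrderComplex (Vertex K V)) :
    Set.InjOn (fun U : Vertex K V => finrank K U.1) σ.1 := by
  intro U hU W hW h
  rcases σ.2.total hU hW with hle | hle
  · exact Subtype.ext (Submodule.eq_of_le_of_finrank_eq hle h)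
  · exact (Subtype.ext (Submodule.eq_of_le_of_finrank_eq hle h.symm)).symm

theorem card_flagType (σ : OrderComplex (Vertex K V)) : (flagType σ).card = σ.1.card :=
  Finset.card_image_of_injOn (injOn_finrank σ)

theorem flagType_subset_Ico (σ : OrderComplex (Vertex K V)) :
    flagType σ ⊆ Finset.Ico (finrank K (bottom σ)) (finrank K V) := by
  intro d hd
  obtain ⟨U, hU, rfl⟩ := mem_flagType.1 hd
  exact Finset.mem_Ico.2 ⟨Submodule.finrank_mono (bottom_le hU), Submodule.finrank_lt U.2.2⟩

theorem card_add_finrank_bottom_le (σ : OrderComplex (Vertex K V)) :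
    σ.1.card + finrank K (bottom σ) ≤ finrank K V := by
  have hcard := Finset.card_le_card (flagType_subset_Ico σ)
  rw [card_flagType, Nat.card_Ico] at hcard
  have := Submodule.finrank_le (bottom σ)
  omega

theorem flagType_eq_Ico {σ : OrderComplex (Vertex K V)} {k : ℕ}
    (hcard : σ.1.card + k = finrank K V) (hk : k ≤ finrank K (bottom σ)) :
    flagType σ = Finset.Ico k (finrank K V) :=
  Finset.eq_of_subset_of_card_le
    ((flagType_subset_Ico σ).trans (Finset.Ico_subset_Ico_left hk))
    (by rw [card_flagType, Nat.card_Ico]; omega)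

theorem member_finrank {σ : OrderComplex (Vertex K V)} {U : Vertex K V} (hU : U ∈ σ.1) :
    member σ (finrank K U.1) = U.1 := by
  have hfilter : {W ∈ σ.1 | finrank K W.1 = finrank K U.1} = {U} :=
    Finset.eq_singleton_iff_unique_mem.2 ⟨Finset.mem_filter.2 ⟨hU, rfl⟩, fun W hW =>
      injOn_finrank σ (Finset.mem_filter.1 hW).1 hU (Finset.mem_filter.1 hW).2⟩
  rw [member, hfilter, Finset.inf_singleton]

theorem member_covBy_member_succ {σ : OrderComplex (Vertex K V)} {d : ℕ} (hd : d ∈ flagType σ)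
    (hd' : d + 1 ∈ flagType σ) : member σ d ⋖ member σ (d + 1) := by
  obtain ⟨U, hU, rfl⟩ := mem_flagType.1 hd
  obtain ⟨W, hW, hWU⟩ := mem_flagType.1 hd'
  rw [← hWU, member_finrank hU, member_finrank hW]
  have hUW : U < W := by
    refine (σ.2.total hU hW).resolve_right (fun hle => ?_) |>.lt_of_ne fun h => ?_
    · have := Submodule.finrank_mono (Subtype.coe_le_coe.2 hle)
      omega
    · subst h
      omega
  refine ⟨hUW, fun C hUC hCW => ?_⟩
  have := Submodule.finrank_lt_finrank_of_lt hUC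
  have := Submodule.finrank_lt_finrank_of_lt hCW
  omega

theorem member_finrank_bottom {σ : OrderComplex (Vertex K V)}
    (h : finrank K (bottom σ) ∈ flagType σ) : member σ (finrank K (bottom σ)) = bottom σ := by
  obtain ⟨U, hU, hUd⟩ := mem_flagType.1 h
  rw [← hUd, member_finrank hU]
  exact (Submodule.eq_of_le_of_finrank_eq (bottom_le hU) hUd.symm).symm

theorem subset_of_member_eq {σ τ : OrderComplex (Vertex K V)} (htype : flagType σ = flagType τ)
    (hmember : member σ = member τ) : σ.1 ⊆ τ.1 := by
  intro U hU
  obtain ⟨W, hW, hWU⟩ := mem_flagType.1 (htype ▸ finrank_mem_flagType hU)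
  have hval : W.1 = U.1 := by rw [← member_finrank hW, ← member_finrank hU, hWU, hmember]
  exact Subtype.ext hval ▸ hW

theorem eq_of_member_eq {σ τ : OrderComplex (Vertex K V)} (htype : flagType σ = flagType τ)
    (hmember : member σ = member τ) : σ = τ :=
  Subtype.ext ((subset_of_member_eq htype hmember).antisymm
    (subset_of_member_eq htype.symm hmember.symm))

theorem member_eq_update [DecidableEq (Vertex K V)] {σ τ : OrderComplex (Vertex K V)}
    (htype : flagType σ = flagType τ) {U : Vertex K V} (hU : U ∈ σ.1) (h : σ.1.erase U ⋖ τ.1) :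
    member τ = Function.update (member σ) (finrank K U.1) (member τ (finrank K U.1)) := by
  classical
  obtain ⟨W, hW, hfacet⟩ := Finset.covBy_iff_exists_erase.1 h
  obtain ⟨W', hW', hdim⟩ := mem_flagType.1 (htype ▸ finrank_mem_flagType hU)
  obtain rfl : W' = W := by
    by_contra hne
    have hmem : W' ∈ σ.1.erase U := hfacet ▸ Finset.mem_erase.2 ⟨hne, hW'⟩
    rw [Finset.mem_erase] at hmem
    exact hmem.1 (injOn_finrank σ hmem.2 hU hdim)
  have filter_erase (ρ : Finset (Vertex K V)) {X : Vertex K V} {d : ℕ} (hd : d ≠ finrank K X.1) :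
      {Y ∈ ρ.erase X | finrank K Y.1 = d} = {Y ∈ ρ | finrank K Y.1 = d} := by
    rw [Finset.filter_erase, Finset.erase_eq_of_notMem]
    exact fun hX => hd (Finset.mem_filter.1 hX).2.symm
  refine Function.eq_update_iff.2 ⟨rfl, fun d hd => ?_⟩
  rw [member, member, ← filter_erase σ.1 hd, ← hfacet, filter_erase τ.1 (hdim ▸ hd)]

end Flags

section Coefficients

variable {K V : Type*} [Field K] [AddCommGroup V] [Module K V]

/-- The embedding of the coefficients `⋀ᵏ 𝔤(σ)` into `⋀ᵏ V`. -/
def ambient (k : ℕ) (σ : OrderComplex (Vertex K V)) :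
    ((lusztig K V).extPower k).obj σ →ₗ[K] ⋀[K]^k V :=
  exteriorPower.map k (bottom σ).subtype

theorem ambient_injective (k : ℕ) (σ : OrderComplex (Vertex K V)) :
    Function.Injective (ambient k σ) :=
  exteriorPower.map_injective_field (Submodule.subtype_injective _)

theorem ambient_map {k : ℕ} {σ τ : OrderComplex (Vertex K V)} (h : σ.1 ⊆ τ.1)
    (x : ((lusztig K V).extPower k).obj τ) :
    ambient k σ (((lusztig K V).extPower k).map h x) = ambient k τ x := by
  change (exteriorPower.map k (bottom σ).subtype ∘ₗ
    exteriorPower.map k (Submodule.inclusion (Finset.inf_mono h))) x = _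
  rw [← exteriorPower.map_comp]
  rfl

theorem card_add_eq_finrank {k : ℕ} (σ : Simplex (Vertex K V) (degD K V k)) :
    σ.1.1.card + k = finrank K V := by
  have := σ.2
  simp only [degD] at this
  omega

variable [FiniteDimensional K V]

theorem le_finrank_bottom_of_ne_zero {k : ℕ} {σ : OrderComplex (Vertex K V)}
    {x : ((lusztig K V).extPower k).obj σ} (hx : x ≠ 0) : k ≤ finrank K (bottom σ) := by
  by_contra! h
  have : Subsingleton (⋀[K]^k (bottom σ)) := subsingleton_exteriorPower_of_finrank_lt h
  exact hx (this.elim _ _)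

instance subsingleton_chain_degD_add_one (k : ℕ) :
    Subsingleton (((lusztig K V).extPower k).Chain (degD K V k + 1)) := by
  refine subsingleton_of_forall_eq 0 fun c => funext fun σ => ?_
  by_contra hne
  have hk := le_finrank_bottom_of_ne_zero hne
  have hle := card_add_finrank_bottom_le σ.1
  have hcard := σ.2
  simp only [degD] at hcard
  omega

variable {k : ℕ} {c : ((lusztig K V).extPower k).Chain (degD K V k)}

theorem flagType_of_mem_supp {σ : Simplex (Vertex K V) (degD K V k)}
    (hσ : σ ∈ LocalSystem.supp c) : flagType σ.1 = Finset.Ico k (finrank K V) :=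
  flagType_eq_Ico (card_add_eq_finrank σ) (le_finrank_bottom_of_ne_zero hσ)

theorem finrank_bottom_of_mem_supp {σ : Simplex (Vertex K V) (degD K V k)}
    (hσ : σ ∈ LocalSystem.supp c) : finrank K (bottom σ.1) = k := by
  have := card_add_finrank_bottom_le σ.1
  have := card_add_eq_finrank σ
  have := le_finrank_bottom_of_ne_zero hσ
  omega

theorem exists_nonempty_suppCofacets [DecidableEq (Vertex K V)] {d : ℕ}
    {σ : Simplex (Vertex K V) (degD K V k)} (hσ : σ ∈ LocalSystem.supp c) (hkd : k ≤ d)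
    (hd : d < finrank K V) :
    ∃ U ∈ σ.1.1, finrank K U.1 = d ∧ ∃ ρ : Simplex (Vertex K V) (degD K V k - 1),
      ρ.1.1 = σ.1.1.erase U ∧ (LocalSystem.suppCofacets c ρ).Nonempty := by
  have hmem : d ∈ flagType σ.1 := flagType_of_mem_supp hσ ▸ Finset.mem_Ico.2 ⟨hkd, hd⟩
  obtain ⟨U, hU, rfl⟩ := mem_flagType.1 hmem
  refine ⟨U, hU, rfl, ⟨⟨σ.1.1.erase U, σ.1.2.mono (by simp)⟩, ?_⟩, rfl, σ, hσ,
    Finset.erase_covBy hU⟩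
  have hcard := Finset.card_erase_add_one hU
  have := σ.2
  dsimp only
  omega

section Cofacets

variable [DecidableEq (Vertex K V)] {σ : Simplex (Vertex K V) (degD K V k)} {U : Vertex K V}
  {ρ : Simplex (Vertex K V) (degD K V k - 1)} (hσ : σ ∈ LocalSystem.supp c) (hU : U ∈ σ.1.1)
  (hρ : ρ.1.1 = σ.1.1.erase U)

include hσ hU hρ

theorem member_eq_update_of_mem_suppCofacets {τ : Simplex (Vertex K V) (degD K V k)}
    (hτ : τ ∈ LocalSystem.suppCofacets c ρ) :
    member τ.1 =
      Function.update (member σ.1) (finrank K U.1) (member τ.1 (finrank K U.1)) :=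
  member_eq_update ((flagType_of_mem_supp hσ).trans (flagType_of_mem_supp hτ.1).symm) hU
    (hρ ▸ hτ.2)

theorem injOn_member_suppCofacets :
    Set.InjOn (fun τ => member τ.1 (finrank K U.1)) (LocalSystem.suppCofacets c ρ) := by
  intro τ hτ τ' hτ' h
  refine Subtype.ext (eq_of_member_eq ?_ ?_)
  · rw [flagType_of_mem_supp hτ.1, flagType_of_mem_supp hτ'.1]
  · rw [member_eq_update_of_mem_suppCofacets hσ hU hρ hτ,
      member_eq_update_of_mem_suppCofacets hσ hU hρ hτ']
    exact congrArg _ h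

theorem pairwise_disjoint_range_ambient (hUk : finrank K U.1 = k) :
    (LocalSystem.suppCofacets c ρ).Pairwise fun τ τ' =>
      Disjoint (LinearMap.range (ambient k τ.1)) (LinearMap.range (ambient k τ'.1)) := by
  intro τ hτ τ' hτ' hne
  have member_eq_bottom {τ} (hτ : τ ∈ LocalSystem.suppCofacets c ρ) :
      member τ.1 (finrank K U.1) = bottom τ.1 := by
    have hbot := (finrank_bottom_of_mem_supp hτ.1).trans hUk.symm
    rw [← hbot]
    refine member_finrank_bottom ?_
    rw [hbot, flagType_of_mem_supp hτ.1, ← flagType_of_mem_supp hσ]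
    exact finrank_mem_flagType hU
  have hbottom : bottom τ.1 ≠ bottom τ'.1 := by
    rw [← member_eq_bottom hτ, ← member_eq_bottom hτ']
    exact (injOn_member_suppCofacets hσ hU hρ).ne hτ hτ' hne
  refine disjoint_range_exteriorPower_map_subtype
    (lt_of_lt_of_eq ?_ (finrank_bottom_of_mem_supp hτ.1))
  refine Submodule.finrank_lt_finrank_of_lt (inf_le_left.lt_of_ne fun h => hbottom ?_)
  exact Submodule.eq_of_le_of_finrank_eq (inf_eq_left.1 h)
    ((finrank_bottom_of_mem_supp hτ.1).trans (finrank_bottom_of_mem_supp hτ'.1).symm)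

end Cofacets

end Coefficients

section LowerBound

variable {K V : Type*} [Field K] [Finite K] [AddCommGroup V] [Module K V] [FiniteDimensional K V]
  {k : ℕ} {c : ((lusztig K V).extPower k).Chain (degD K V k)}

/-- The flags in the support of `c`, as functions from dimensions to subspaces. -/
def suppMembers (c : ((lusztig K V).extPower k).Chain (degD K V k)) :
    Finset (ℕ → Submodule K V) :=
  (Set.toFinite ((fun σ => member σ.1) '' LocalSystem.supp c)).toFinset

theorem mem_suppMembers {f : ℕ → Submodule K V} :
    f ∈ suppMembers c ↔ ∃ σ ∈ LocalSystem.supp c, member σ.1 = f :=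
  Set.Finite.mem_toFinset _

theorem card_suppMembers_le : (suppMembers c).card ≤ (LocalSystem.supp c).ncard :=
  (Set.ncard_eq_toFinset_card _).symm.trans_le Set.ncard_image_le

theorem mapsTo_member_suppCofacets [DecidableEq (Vertex K V)]
    {σ : Simplex (Vertex K V) (degD K V k)} {U : Vertex K V}
    {ρ : Simplex (Vertex K V) (degD K V k - 1)} (hσ : σ ∈ LocalSystem.supp c) (hU : U ∈ σ.1.1)
    (hρ : ρ.1.1 = σ.1.1.erase U) :
    Set.MapsTo (fun τ => member τ.1 (finrank K U.1)) (LocalSystem.suppCofacets c ρ)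
      {x | Function.update (member σ.1) (finrank K U.1) x ∈ suppMembers c} := fun τ hτ =>
  mem_suppMembers.2 ⟨τ, hτ.1, member_eq_update_of_mem_suppCofacets hσ hU hρ hτ⟩

theorem isExchangeable_suppMembers (hc : c ∈ cyclesD K V k) :
    IsExchangeable k (finrank K V) (suppMembers c) := by
  classical
  refine ⟨fun f hf d hkd hd => ?_, fun f hf d hkd hd => ?_, fun hk f hf => ?_⟩ <;>
    obtain ⟨σ, hσ, rfl⟩ := mem_suppMembers.1 hf
  · apply member_covBy_member_succ <;> rw [flagType_of_mem_supp hσ, Finset.mem_Ico] <;> omega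
  · obtain ⟨U, hU, rfl, ρ, hρ, hne⟩ := exists_nonempty_suppCofacets hσ hkd hd
    exact ((LocalSystem.nontrivial_suppCofacets ambient_map (ambient_injective k) hc
      hne).image_of_injOn (injOn_member_suppCofacets hσ hU hρ)).mono
      (mapsTo_member_suppCofacets hσ hU hρ).image_subset
  · obtain ⟨U, hU, hUk, ρ, hρ, hne⟩ := exists_nonempty_suppCofacets hσ le_rfl hk
    refine (LocalSystem.two_lt_encard_suppCofacets ambient_map (ambient_injective k) hc hne
      (pairwise_disjoint_range_ambient hσ hU hρ hUk)).trans_le ?_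
    have hle := Set.encard_le_encard_of_injOn (mapsTo_member_suppCofacets hσ hU hρ)
      (injOn_member_suppCofacets hσ hU hρ)
    rwa [hUk] at hle

theorem factorial_le_two_mul_ncard_supp (hk : k ≤ finrank K V) (hc : c ∈ cyclesD K V k)
    (hne : c ≠ 0) :
    (finrank K V - k + 2).factorial ≤ 2 * (LocalSystem.supp c).ncard := by
  obtain ⟨σ, hσ⟩ := Function.ne_iff.1 hne
  exact ((isExchangeable_suppMembers hc).factorial_le_two_mul_card hk
    ⟨_, mem_suppMembers.2 ⟨σ, hσ, rfl⟩⟩).trans (Nat.mul_le_mul_left 2 card_suppMembers_le)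

end LowerBound

section Orderings

open Equiv

/-- The set of the first `t` entries of the ordering `r 0, r 1, …` of `Fin n`. -/
def initial {n : ℕ} (r : Perm (Fin n)) (t : ℕ) : Set (Fin n) := {a | (r.symm a : ℕ) < t}

theorem apply_mem_initial {n t : ℕ} {r : Perm (Fin n)} {i : Fin n} : r i ∈ initial r t ↔ i < t := by
  simp [initial]

theorem initial_strictMonoOn {n : ℕ} (r : Perm (Fin n)) :
    StrictMonoOn (initial r) (Set.Iic n) := by
  intro s _ t ht hst
  refine Set.ssubset_iff_exists.2 ⟨fun a ha => lt_trans ha hst, r ⟨s, hst.trans_le ht⟩, ?_⟩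
  simp [apply_mem_initial, hst]

theorem initial_nontrivial {m : ℕ} (r : Perm (Fin (m + 2))) (t : ℕ) :
    (initial r (t + 2)).Nontrivial :=
  ⟨r 0, apply_mem_initial.2 (by simp), r 1, apply_mem_initial.2 (by simp), by simp⟩

theorem initial_mul_swap {n t : ℕ} (r : Perm (Fin n)) {i j : Fin n} (h : i < t ↔ j < t) :
    initial (r * swap i j) t = initial r t := by
  ext a
  obtain ⟨x, rfl⟩ := r.surjective a
  simp only [initial, Set.mem_ofPred_eq, Perm.mul_def, symm_trans_apply, symm_swap,
    symm_apply_apply, swap_apply_def]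
  split_ifs with hi hj
  · rw [hi, h]
  · rw [hj, h]
  · rfl

theorem eq_one_or_eq_swap {α : Type*} [Fintype α] [DecidableEq α] {s : Perm α} {a b : α}
    (h : s.support ⊆ {a, b}) : s = 1 ∨ s = swap a b := by
  refine or_iff_not_imp_left.2 fun hs => ?_
  obtain ⟨x, y, hxy, rfl⟩ := Perm.card_support_eq_two.1
    (((Finset.card_le_card h).trans Finset.card_le_two).antisymm
      (Perm.two_le_card_support_of_ne_one hs))
  rw [Perm.support_swap hxy, Finset.insert_subset_iff, Finset.singleton_subset_iff,
    Finset.mem_insert, Finset.mem_singleton, Finset.mem_insert, Finset.mem_singleton] at h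
  obtain ⟨rfl | rfl, rfl | rfl⟩ := h
  exacts [absurd rfl hxy, rfl, swap_comm .., absurd rfl hxy]

theorem eq_or_eq_mul_swap {m : ℕ} {r r' : Perm (Fin (m + 2))}
    (h : ∀ i < m, initial r (i + 2) = initial r' (i + 2)) : r' = r ∨ r' = r * swap 0 1 := by
  have lt_iff (x : Fin (m + 2)) {t : ℕ} (ht : 2 ≤ t) : (r.symm (r' x) : ℕ) < t ↔ x < t := by
    obtain ⟨i, rfl⟩ := Nat.exists_eq_add_of_le' ht
    by_cases hi : i < m
    · exact Set.ext_iff.1 (h i hi) (r' x) |>.trans apply_mem_initial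
    · omega
  have hsupp : (r⁻¹ * r').support ⊆ {0, 1} := by
    intro x
    contrapose
    rw [Finset.mem_insert, Finset.mem_singleton, Perm.notMem_support, not_or]
    rintro ⟨h0, h1⟩
    have hx : 2 ≤ (x : ℕ) := by
      rw [Fin.ext_iff, Fin.val_zero] at h0
      rw [Fin.ext_iff, Fin.val_one] at h1
      omega
    have := lt_iff x hx
    have := lt_iff x (t := x + 1) (by omega)
    refine Fin.ext ?_
    change (r.symm (r' x) : ℕ) = x
    omega
  simpa only [inv_mul_eq_iff_eq_mul, mul_one] using eq_one_or_eq_swap hsupp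

theorem sum_perm_eq_zero {α M : Type*} [Fintype α] [DecidableEq α] [AddCommGroup M]
    {f : Perm α → M} {i j : α} (hij : i ≠ j) (hf : ∀ r, f (r * swap i j) = -f r) :
    ∑ r, f r = 0 := by
  refine Finset.sum_involution (fun r _ => r * swap i j) (fun r _ => ?_) (fun r _ _ h => ?_)
    (fun _ _ => Finset.mem_univ _) fun r _ => ?_
  · rw [hf, add_neg_cancel]
  · exact hij (swap_eq_one_iff.1 (mul_eq_left.1 h))
  · rw [mul_assoc, swap_mul_self, mul_one]

end Orderings

section Frames

open Equiv Submodule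

/-- Points `p₀, …, p_{m+1}` in general position modulo the span of `κ` linearly independent
vectors, the core. -/
structure Frame (K V : Type*) [Field K] [AddCommGroup V] [Module K V] (κ m : ℕ) where
  point : Fin (m + 2) → V
  core : Fin κ → V
  linearIndependent_core : LinearIndependent K core
  affineIndependent : AffineIndependent K ((span K (Set.range core)).mkQ ∘ point)

variable {K V : Type*} [Field K] [AddCommGroup V] [Module K V] {κ m : ℕ}

theorem exists_frame [FiniteDimensional K V] (h : finrank K V = κ + (m + 1)) :
    Nonempty (Frame K V κ m) := by
  let core := Module.finBasisOfFinrankEq K V h ∘ Fin.castAdd (m + 1)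
  have hcore : LinearIndependent K core :=
    (Module.finBasisOfFinrankEq K V h).linearIndependent.comp _ (Fin.castAdd_injective κ (m + 1))
  let W := span K (Set.range core)
  have hquot : finrank K (V ⧸ W) = m + 1 := by
    have hW : finrank K W = κ := by simpa using finrank_span_eq_card hcore
    have := finrank_quotient_add_finrank W
    omega
  obtain ⟨b⟩ := AffineBasis.exists_affineBasis_of_finiteDimensional (ι := Fin (m + 2)) (k := K)
    (P := V ⧸ W) (by rw [Fintype.card_fin, hquot])
  have hlift : W.mkQ ∘ Function.surjInv W.mkQ_surjective ∘ b = b :=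
    funext fun i => Function.surjInv_eq W.mkQ_surjective (b i)
  exact ⟨⟨_, core, hcore, hlift ▸ b.ind⟩⟩

namespace Frame

variable (F : Frame K V κ m)

theorem point_sub_notMem_span_core {a b : Fin (m + 2)} (hab : a ≠ b) :
    F.point a - F.point b ∉ span K (Set.range F.core) := fun h =>
  hab (F.affineIndependent.injective ((Submodule.Quotient.eq _).2 h))

/-- The subspace spanned by the core and the differences of the points with index in `T`. -/
def face (T : Set (Fin (m + 2))) : Submodule K V :=
  span K (Set.range F.core) ⊔ vectorSpan K (F.point '' T)

theorem core_mem_face (T : Set (Fin (m + 2))) (i : Fin κ) : F.core i ∈ F.face T :=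
  mem_sup_left (subset_span (Set.mem_range_self i))

theorem point_sub_mem_face {T : Set (Fin (m + 2))} {a b : Fin (m + 2)} (ha : a ∈ T) (hb : b ∈ T) :
    F.point a - F.point b ∈ F.face T :=
  mem_sup_right (vsub_mem_vectorSpan K (Set.mem_image_of_mem _ ha) (Set.mem_image_of_mem _ hb))

theorem face_mono : Monotone F.face := fun _ _ h =>
  sup_le_sup_left (vectorSpan_mono K (Set.image_mono h)) _

theorem map_mkQ_face (T : Set (Fin (m + 2))) :
    (F.face T).map (span K (Set.range F.core)).mkQ =
      vectorSpan K (((span K (Set.range F.core)).mkQ ∘ F.point) '' T) := by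
  rw [face, Submodule.map_sup, mkQ_map_self, bot_sup_eq, Set.image_comp]
  exact AffineMap.map_vectorSpan (span K (Set.range F.core)).mkQ.toAffineMap

theorem face_injOn : Set.InjOn F.face {T | T.Nontrivial} := by
  intro T hT T' _ h
  have hspan := congrArg (map (span K (Set.range F.core)).mkQ) h
  rw [map_mkQ_face, map_mkQ_face, F.affineIndependent.vectorSpan_image_eq_iff] at hspan
  exact hspan.resolve_right fun hsub => Set.not_subsingleton_iff.2 hT hsub.1

theorem face_ne_bot {T : Set (Fin (m + 2))} (hT : T.Nontrivial) : F.face T ≠ ⊥ := by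
  obtain ⟨a, ha, b, hb, hab⟩ := hT
  intro h
  have hzero : F.point a - F.point b = 0 := (mem_bot K).1 (h ▸ F.point_sub_mem_face ha hb)
  exact F.point_sub_notMem_span_core hab (hzero ▸ zero_mem _)

theorem face_initial_strictMonoOn (r : Perm (Fin (m + 2))) :
    StrictMonoOn (fun t => F.face (initial r (t + 2))) (Set.Iic m) :=
  (F.face_mono.monotoneOn _ |>.strictMonoOn_of_injOn F.face_injOn).comp
    (fun _ hs _ ht hst => initial_strictMonoOn r (Nat.add_le_add_right hs 2)
      (Nat.add_le_add_right ht 2) (Nat.add_lt_add_right hst 2))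
    fun t _ => initial_nontrivial r t

/-- The face of the first `i + 2` points in the ordering `r`, as a vertex of the building. -/
def vert (r : Perm (Fin (m + 2))) (i : Fin m) : Vertex K V :=
  ⟨F.face (initial r (i + 2)), F.face_ne_bot (initial_nontrivial r i),
    (F.face_initial_strictMonoOn r i.2.le Set.self_mem_Iic i.2).ne_top⟩

theorem vert_strictMono (r : Perm (Fin (m + 2))) : StrictMono (F.vert r) := fun i j hij =>
  F.face_initial_strictMonoOn r i.2.le j.2.le hij

theorem vert_mul_swap (r : Perm (Fin (m + 2))) {a b : Fin (m + 2)} {i : Fin m}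
    (h : (a : ℕ) < i + 2 ↔ (b : ℕ) < i + 2) : F.vert (r * swap a b) i = F.vert r i :=
  Subtype.ext (congrArg F.face (initial_mul_swap r h))

theorem vert_eq_iff {r r' : Perm (Fin (m + 2))} :
    F.vert r' = F.vert r ↔ r' = r ∨ r' = r * swap 0 1 := by
  refine ⟨fun h => eq_or_eq_mul_swap fun i hi => ?_, ?_⟩
  · exact F.face_injOn (initial_nontrivial r i) (initial_nontrivial r' i)
      (congrArg Subtype.val (congrFun h ⟨i, hi⟩)).symm
  · rintro (rfl | rfl)
    exacts [rfl, funext fun i => F.vert_mul_swap r (by simp)]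

variable {d : ℤ} (hd : (m : ℤ) = d + 1)

open Classical in
/-- The flag of the faces of the first `2, …, m + 1` points in the ordering `r`. -/
def simplex (r : Perm (Fin (m + 2))) : Simplex (Vertex K V) d :=
  ⟨⟨Finset.univ.image (F.vert r), by
    simpa using (F.vert_strictMono r).monotone.isChain_range⟩, by
    rw [Finset.card_image_of_injective _ (F.vert_strictMono r).injective, Finset.card_fin, hd]⟩

theorem coe_simplex (r : Perm (Fin (m + 2))) :
    ((F.simplex hd r).1.1 : Set (Vertex K V)) = Set.range (F.vert r) := by
  classical
  exact Finset.coe_image.trans (by rw [Finset.coe_univ, Set.image_univ])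

theorem simplex_eq_iff {r r' : Perm (Fin (m + 2))} :
    F.simplex hd r' = F.simplex hd r ↔ r' = r ∨ r' = r * swap 0 1 := by
  rw [← F.vert_eq_iff, ← (F.vert_strictMono r').range_inj (F.vert_strictMono r),
    ← F.coe_simplex hd, ← F.coe_simplex hd, Finset.coe_inj]
  exact Subtype.ext_iff.trans Subtype.ext_iff

open Classical in
theorem filter_simplex_eq (r : Perm (Fin (m + 2))) :
    ({r' | F.simplex hd r' = F.simplex hd r} : Finset _) = {r, r * swap 0 1} := by
  ext r'
  simp [F.simplex_eq_iff hd]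

theorem face_initial_le_bottom (r : Perm (Fin (m + 2))) :
    F.face (initial r 2) ≤ bottom (F.simplex hd r).1 := by
  classical
  refine Finset.le_inf fun U hU => ?_
  obtain ⟨i, -, rfl⟩ := Finset.mem_image.1 hU
  exact F.face_mono fun a ha => lt_of_lt_of_le ha (Nat.le_add_left 2 i)

/-- The exterior product of `v` with the core. -/
def wedge (v : V) : ⋀[K]^(κ + 1) V := exteriorPower.ιMulti K (κ + 1) (Matrix.vecCons v F.core)

theorem wedge_sub (v w : V) : F.wedge (v - w) = F.wedge v - F.wedge w :=
  congrArg (· F.core) (map_sub (exteriorPower.ιMulti K (κ + 1)).curryLeft v w)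

theorem wedge_point_sub_ne_zero {a b : Fin (m + 2)} (hab : a ≠ b) :
    F.wedge (F.point a - F.point b) ≠ 0 :=
  exteriorPower_ιMulti_ne_zero (linearIndependent_finCons.2
    ⟨F.linearIndependent_core, F.point_sub_notMem_span_core hab⟩)

theorem wedge_mem_range_ambient {σ : OrderComplex (Vertex K V)} {v : V} (hv : v ∈ bottom σ)
    (hcore : ∀ i, F.core i ∈ bottom σ) : F.wedge v ∈ LinearMap.range (ambient (κ + 1) σ) := by
  refine ⟨exteriorPower.ιMulti K (κ + 1) (Matrix.vecCons ⟨v, hv⟩ fun i => ⟨F.core i, hcore i⟩), ?_⟩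
  refine (exteriorPower.map_apply_ιMulti ..).trans (congrArg _ (funext fun i => ?_))
  refine Fin.cases rfl (fun i => rfl) i

/-- The contribution of the ordering `r` to the chain of the frame. -/
def term (r : Perm (Fin (m + 2))) : ⋀[K]^(κ + 1) V := Perm.sign r • F.wedge (F.point (r 0))

theorem term_mul_swap (r : Perm (Fin (m + 2))) {a b : Fin (m + 2)} (hab : a ≠ b) :
    F.term (r * swap a b) = -(Perm.sign r • F.wedge (F.point (r (swap a b 0)))) := by
  rw [term, Perm.sign_mul, Perm.sign_swap hab, mul_neg_one, Units.neg_smul, Perm.mul_apply]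

open Classical in
/-- The coefficient of `σ` in the chain of the frame, as an element of `⋀ᵏ V`: the sum of the terms
of all orderings with flag `σ`. -/
def coeff (σ : Simplex (Vertex K V) d) : ⋀[K]^(κ + 1) V :=
  ∑ r with F.simplex hd r = σ, F.term r

theorem coeff_simplex (r : Perm (Fin (m + 2))) :
    F.coeff hd (F.simplex hd r) = Perm.sign r • F.wedge (F.point (r 0) - F.point (r 1)) := by
  rw [coeff, filter_simplex_eq, Finset.sum_pair (by simp), F.term_mul_swap r (by simp),
    swap_apply_left, wedge_sub, smul_sub, sub_eq_add_neg, term]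

theorem coeff_eq_zero {σ : Simplex (Vertex K V) d} (hσ : σ ∉ Set.range (F.simplex hd)) :
    F.coeff hd σ = 0 := by
  classical
  exact Finset.sum_eq_zero fun r hr => absurd ⟨r, (Finset.mem_filter.1 hr).2⟩ hσ

theorem coeff_mem_range_ambient (σ : Simplex (Vertex K V) d) :
    F.coeff hd σ ∈ LinearMap.range (ambient (κ + 1) σ.1) := by
  by_cases hσ : σ ∈ Set.range (F.simplex hd)
  · obtain ⟨r, rfl⟩ := hσ
    rw [coeff_simplex]
    refine smul_mem _ ((Perm.sign r : ℤ) : K) (F.wedge_mem_range_ambient ?_ fun i => ?_)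
    · exact F.face_initial_le_bottom hd r
        (F.point_sub_mem_face (apply_mem_initial.2 (by simp)) (apply_mem_initial.2 (by simp)))
    · exact F.face_initial_le_bottom hd r (F.core_mem_face _ i)
  · rw [coeff_eq_zero F hd hσ]
    exact zero_mem _

/-- The alternating sum of the flags of all orderings of the points, the flag of `r` having the
coefficient `± p_{r 0} ∧ core`; the terms of `r` and `r * swap 0 1` belong to the same flag. -/
def chain : ((lusztig K V).extPower (κ + 1)).Chain d :=
  fun σ => (F.coeff_mem_range_ambient hd σ).choose

theorem ambient_chain (σ : Simplex (Vertex K V) d) :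
    ambient (κ + 1) σ.1 (F.chain hd σ) = F.coeff hd σ :=
  (F.coeff_mem_range_ambient hd σ).choose_spec

theorem chain_ne_zero : F.chain hd ≠ 0 := by
  intro h
  have hcoeff := F.ambient_chain hd (F.simplex hd 1)
  rw [h, Pi.zero_apply, map_zero, coeff_simplex, Perm.sign_one, one_smul] at hcoeff
  exact F.wedge_point_sub_ne_zero (by simp) hcoeff.symm

theorem supp_chain_subset : LocalSystem.supp (F.chain hd) ⊆ Set.range (F.simplex hd) := by
  intro σ hσ
  contrapose! hσ
  refine not_ne_iff.2 (ambient_injective _ _ ?_)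
  rw [ambient_chain, coeff_eq_zero F hd hσ, map_zero]

theorem two_mul_ncard_supp_chain_le :
    2 * (LocalSystem.supp (F.chain hd)).ncard ≤ (m + 2).factorial := by
  classical
  have hsupp : (LocalSystem.supp (F.chain hd)).ncard ≤
      (Finset.univ.image (F.simplex hd)).card := by
    rw [← Set.ncard_coe_finset]
    exact Set.ncard_le_ncard (by simpa using F.supp_chain_subset hd) (Finset.finite_toSet _)
  have hfiber : 2 * (Finset.univ.image (F.simplex hd)).card ≤
      (Finset.univ : Finset (Perm (Fin (m + 2)))).card := by
    refine Finset.mul_card_image_le_card _ 2 fun σ hσ => ?_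
    obtain ⟨r, -, rfl⟩ := Finset.mem_image.1 hσ
    rw [filter_simplex_eq, Finset.card_pair (by simp)]
  rw [Finset.card_univ, Fintype.card_perm, Fintype.card_fin] at hfiber
  omega

theorem image_erase_vert_mul_swap [DecidableEq (Vertex K V)] (r : Perm (Fin (m + 2)))
    (i : Fin m) :
    (Finset.univ.erase i).image (F.vert (r * swap i.succ.castSucc i.succ.succ)) =
      (Finset.univ.erase i).image (F.vert r) := by
  refine Finset.image_congr fun j hj => F.vert_mul_swap r ?_
  have hji : (j : ℕ) ≠ i := Fin.val_ne_iff.2 (by simpa using hj)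
  rw [Fin.val_castSucc, Fin.val_succ, Fin.val_succ, Fin.val_succ]
  omega

theorem sum_facet_smul_term_eq_zero [DecidableEq (Vertex K V)] (ρ : Finset (Vertex K V))
    (i : Fin m) :
    ∑ r, (if ρ = (Finset.univ.erase i).image (F.vert r) then (-1 : K) ^ (i : ℕ) else 0) •
      F.term r = 0 := by
  have hne : i.succ.castSucc ≠ i.succ.succ := Fin.castSucc_lt_succ.ne
  refine sum_perm_eq_zero hne fun r => ?_
  rw [image_erase_vert_mul_swap, F.term_mul_swap r hne, smul_neg,
    swap_apply_of_ne_of_ne (by simp [Fin.ext_iff]) (Fin.succ_ne_zero _).symm, term]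

section Cycle

variable [Finite K] [FiniteDimensional K V]

open Classical in
theorem sum_incidence_smul_coeff_eq_zero (ρ : Finset (Vertex K V)) :
    ∑ σ : Simplex (Vertex K V) d, incidence K ρ σ.1.1 • F.coeff hd σ = 0 := by
  calc ∑ σ : Simplex (Vertex K V) d, incidence K ρ σ.1.1 • F.coeff hd σ
      = ∑ σ, ∑ r with F.simplex hd r = σ, incidence K ρ (F.simplex hd r).1.1 • F.term r := by
        refine Finset.sum_congr rfl fun σ _ => ?_
        rw [coeff, Finset.smul_sum]
        exact Finset.sum_congr rfl fun r hr => by rw [(Finset.mem_filter.1 hr).2]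
    _ = ∑ r, incidence K ρ (Finset.univ.image (F.vert r)) • F.term r :=
        Finset.sum_fiberwise ..
    _ = ∑ i, ∑ r, (if ρ = (Finset.univ.erase i).image (F.vert r) then (-1 : K) ^ (i : ℕ) else 0) •
          F.term r := by
        rw [Finset.sum_comm]
        simp only [incidence_image_univ (F.vert_strictMono _), Finset.sum_smul]
    _ = 0 := Finset.sum_eq_zero fun i _ => F.sum_facet_smul_term_eq_zero ρ i

theorem chain_mem_cycles : F.chain hd ∈ ((lusztig K V).extPower (κ + 1)).cycles d := by
  refine (LocalSystem.mem_cycles_iff ambient_map (ambient_injective _)).2 fun ρ => ?_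
  simp only [ambient_chain]
  exact F.sum_incidence_smul_coeff_eq_zero hd ρ.1.1

end Cycle

end Frame

end Frames

section MinimalSupport

variable {K V : Type*} [Field K] [Finite K] [AddCommGroup V] [Module K V] [FiniteDimensional K V]
  {k : ℕ}

theorem exists_homologyClass_ne_zero_and_two_mul_ncard_supp_le (hk : 1 ≤ k)
    (hkn : k + 1 ≤ finrank K V) : ∃ z : cyclesD K V k, LocalSystem.homologyClass _ z ≠ 0 ∧
      2 * (LocalSystem.supp z.1).ncard ≤ (finrank K V - k + 2).factorial := by
  obtain ⟨κ, rfl⟩ := Nat.exists_eq_add_of_le' hk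
  obtain ⟨m, hm⟩ : ∃ m, finrank K V = κ + (m + 1) := ⟨finrank K V - κ - 1, by omega⟩
  obtain ⟨F⟩ := exists_frame hm
  have hd : (m : ℤ) = degD K V (κ + 1) + 1 := by
    simp only [degD]
    omega
  rw [show finrank K V - (κ + 1) + 2 = m + 2 by omega]
  exact ⟨⟨F.chain hd, F.chain_mem_cycles hd⟩, fun h => F.chain_ne_zero hd
    (congrArg Subtype.val (LocalSystem.homologyClass_eq_zero_iff.1 h)),
    F.two_mul_ncard_supp_chain_le hd⟩

end MinimalSupport

end TwistedBuilding

end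

theorem theorem1p6 {K V : Type*} [Field K] [Finite K] [AddCommGroup V] [Module K V]
    [FiniteDimensional K V] (n k : ℕ) (hn : Module.finrank K V = n) (hk : 1 ≤ k)
    (hkn : k + 1 ≤ n) :
    (∀ w : TwistedBuilding.D K V k, ∃! z : TwistedBuilding.cyclesD K V k,
      TwistedBuilding.LocalSystem.homologyClass _ z = w) ∧
    IsLeast {N : ℕ | ∃ z : TwistedBuilding.cyclesD K V k,
        (TwistedBuilding.LocalSystem.homologyClass _ z : TwistedBuilding.D K V k) ≠ 0 ∧
        (TwistedBuilding.LocalSystem.supp z.1).ncard = N}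
      ((n - k + 2).factorial / 2) := by
  subst hn
  have lower (z : TwistedBuilding.cyclesD K V k)
      (hz : TwistedBuilding.LocalSystem.homologyClass _ z ≠ 0) :
      (Module.finrank K V - k + 2).factorial ≤ 2 * (TwistedBuilding.LocalSystem.supp z.1).ncard :=
    TwistedBuilding.factorial_le_two_mul_ncard_supp (by omega) z.2 fun h =>
      hz (TwistedBuilding.LocalSystem.homologyClass_eq_zero_iff.2 (Subtype.ext h))
  refine ⟨TwistedBuilding.LocalSystem.homologyClass_bijective.existsUnique, ?_, ?_⟩
  · obtain ⟨z, hz, upper⟩ :=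
      TwistedBuilding.exists_homologyClass_ne_zero_and_two_mul_ncard_supp_le hk hkn
    have := lower z hz
    exact ⟨z, hz, by omega⟩
  · rintro N ⟨z, hz, rfl⟩
    have := lower z hz
    omega
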